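/- A \emph{signed graph} is a finite graph $G$ (loops and parallel edges allowed) in which each edge is labelled with a sign $+$ or $-$. An \emph{orientation} of $G$ divides each edge into two half-edges and directs each half-edge either towards or from its end-vertex, so that the two half-edges of a positive edge have opposite directions (one towards, one from its end-vertex), while the two half-edges of a negative edge are both directed towards or both directed from their end-vertices. For an integer $k\ge 2$, a \emph{nowhere-zero $k$-flow} on $G$ is an orientation of $G$ together with an assignment $\phi\colon E(G)\to\{\pm1,\dots,\pm(k-1)\}$ such that at each vertex the sum of the values on the incoming half-edges equals the sum of the values on the outgoing half-edges. A circuit of $G$ (a loop counts as a circuit of length $1$ and two parallel edges as a circuit of length $2$) is \emph{balanced} if it contains an even number of negative edges, and \emph{unbalanced} otherwise. A \emph{signed circuit} of $G$ is a subgraph of one of the following types: (1) a balanced circuit; (2) the union of two disjoint unbalanced circuits with a path that meets the circuits only at its ends; (3) the union of two distinct unbalanced circuits that meet at a single vertex. A \emph{signed circuit cover} of $G$ is a finite collection $\mathcal C$ of signed circuits of $G$ such that each edge of $G$ is contained in at least one member of $\mathcal C$; its \emph{total length} is $\sum_{C\in\mathcal C}|E(C)|$. \textbf{Corollary.} Let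 $k\ge 2$ be an integer. If a signed graph $G$ admits a nowhere-zero $k$-flow, then $G$ has a signed circuit cover of total length at most $2(k-1)|E(G)|$. -/

import Mathlib

open scoped Graph

/-- A signed graph: a multigraph (loops and parallel edges allowed) whose edges carry a sign
`1` or `-1`.  The value of `sign` outside the edge set plays no role. -/
structure SignedGraph (α β : Type*) where
  /-- The underlying multigraph. -/
  graph : Graph α β
  /-- The sign of an edge. -/
  sign : β → ℤˣ

/-! ### Circuits and paths as multigraphs -/

/-- `C` is a circuit: its vertices are the distinct `v 0, …, v n`, its edges are the distinct
`e 0, …, e n`, and `e i` joins `v i` to `v (i + 1)`, indices taken modulo `n + 1`.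
A loop is a circuit of length one, two parallel edges form a circuit of length two. -/
def Graph.IsCircuit {α β : Type*} (C : Graph α β) : Prop :=
  ∃ (n : ℕ) (v : Fin (n + 1) → α) (e : Fin (n + 1) → β),
    Function.Injective v ∧ Function.Injective e ∧
    V(C) = Set.range v ∧ E(C) = Set.range e ∧
    ∀ i, C.IsLink (e i) (v i) (v (i + 1))

/-- `P` is a path with ends `x` and `y`; the trivial path (one vertex, no edge) is allowed. -/
def Graph.IsPathBetween {α β : Type*} (P : Graph α β) (x y : α) : Prop :=
  ∃ (n : ℕ) (v : Fin (n + 1) → α) (e : Fin n → β),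
    Function.Injective v ∧ v 0 = x ∧ v (Fin.last n) = y ∧
    V(P) = Set.range v ∧ E(P) = Set.range e ∧
    ∀ i : Fin n, P.IsLink (e i) (v i.castSucc) (v i.succ)

namespace SignedGraph

variable {α β : Type*}

/-- The set of negative edges of a subgraph `H`. -/
def negEdges (G : SignedGraph α β) (H : Graph α β) : Set β :=
  {e | e ∈ E(H) ∧ G.sign e = -1}

/-- `C` is a circuit of `G` with an even number of negative edges. -/
def IsBalancedCircuit (G : SignedGraph α β) (C : Graph α β) : Prop :=
  C ≤ G.graph ∧ C.IsCircuit ∧ Even (G.negEdges C).ncard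

/-- `C` is a circuit of `G` with an odd number of negative edges. -/
def IsUnbalancedCircuit (G : SignedGraph α β) (C : Graph α β) : Prop :=
  C ≤ G.graph ∧ C.IsCircuit ∧ ¬ Even (G.negEdges C).ncard

/-- `H` is the union of two disjoint unbalanced circuits with a path that meets the circuits
only at its ends. -/
def IsLongBicircuit (G : SignedGraph α β) (H : Graph α β) : Prop :=
  H ≤ G.graph ∧ ∃ (C₁ C₂ P : Graph α β) (x₁ x₂ : α),
    G.IsUnbalancedCircuit C₁ ∧ G.IsUnbalancedCircuit C₂ ∧
    P ≤ G.graph ∧ P.IsPathBetween x₁ x₂ ∧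
    V(C₁) ∩ V(C₂) = ∅ ∧ V(P) ∩ V(C₁) = {x₁} ∧ V(P) ∩ V(C₂) = {x₂} ∧
    V(H) = V(C₁) ∪ V(C₂) ∪ V(P) ∧ E(H) = E(C₁) ∪ E(C₂) ∪ E(P)

/-- `H` is the union of two unbalanced circuits that meet at a single vertex (and in no edge:
the last condition rules out taking one and the same loop twice). -/
def IsTightBicircuit (G : SignedGraph α β) (H : Graph α β) : Prop :=
  H ≤ G.graph ∧ ∃ (C₁ C₂ : Graph α β) (x : α),
    G.IsUnbalancedCircuit C₁ ∧ G.IsUnbalancedCircuit C₂ ∧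
    V(C₁) ∩ V(C₂) = {x} ∧ E(C₁) ∩ E(C₂) = ∅ ∧
    V(H) = V(C₁) ∪ V(C₂) ∧ E(H) = E(C₁) ∪ E(C₂)

/-- A signed circuit of `G`: a balanced circuit or an unbalanced bicircuit. -/
def IsSignedCircuit (G : SignedGraph α β) (H : Graph α β) : Prop :=
  G.IsBalancedCircuit H ∨ G.IsLongBicircuit H ∨ G.IsTightBicircuit H

/-- A (finite) signed circuit cover of `G`: a collection of signed circuits of `G` such that
each edge of `G` is contained in at least one of them. -/
def IsSignedCircuitCover (G : SignedGraph α β) (𝒞 : Finset (Graph α β)) : Prop :=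
  (∀ C ∈ 𝒞, G.IsSignedCircuit C) ∧ ∀ e ∈ E(G.graph), ∃ C ∈ 𝒞, e ∈ E(C)

/-- The total length of a collection of subgraphs: the sum of their numbers of edges. -/
noncomputable def totalLength (𝒞 : Finset (Graph α β)) : ℕ :=
  ∑ C ∈ 𝒞, E(C).ncard

/-- An orientation (bidirection) of `G`.  Each edge `e` is divided into two half-edges `(e, 0)`
and `(e, 1)`, whose end-vertices are the two ends of `e` (both equal to the same vertex if `e` is
a loop).  A half-edge has direction `1` if it is directed towards its end-vertex and `-1` if it is
directed from its end-vertex.  The two half-edges of a positive edge have opposite directions,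
those of a negative edge have the same direction. -/
structure Orientation (G : SignedGraph α β) where
  /-- The end-vertex of a half-edge. -/
  endpoint : E(G.graph) → Fin 2 → α
  /-- The direction of a half-edge relative to its end-vertex. -/
  dir : E(G.graph) → Fin 2 → ℤˣ
  isLink : ∀ e : E(G.graph), G.graph.IsLink e (endpoint e 0) (endpoint e 1)
  compat : ∀ e : E(G.graph), dir e 0 * dir e 1 = -G.sign e

/-- The half-edges at `v` that are directed towards `v`. -/
def Orientation.incoming {G : SignedGraph α β} (τ : G.Orientation) (v : α) :
    Set (E(G.graph) × Fin 2) :=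
  {h | τ.endpoint h.1 h.2 = v ∧ τ.dir h.1 h.2 = 1}

/-- The half-edges at `v` that are directed from `v`. -/
def Orientation.outgoing {G : SignedGraph α β} (τ : G.Orientation) (v : α) :
    Set (E(G.graph) × Fin 2) :=
  {h | τ.endpoint h.1 h.2 = v ∧ τ.dir h.1 h.2 = -1}

/-- Kirchhoff's law for the integer valuation `φ` with respect to the orientation `τ` (used for
graphs with finitely many edges only, so that the sums are finite). -/
def IsFlow {G : SignedGraph α β} (τ : G.Orientation) (φ : E(G.graph) → ℤ) : Prop :=
  ∀ v ∈ V(G.graph), ∑ᶠ h ∈ τ.incoming v, φ h.1 = ∑ᶠ h ∈ τ.outgoing v, φ h.1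

/-- `G` admits a nowhere-zero `k`-flow: an orientation together with an integer flow all of whose
values lie in `{±1, …, ±(k - 1)}`. -/
def AdmitsNowhereZeroFlow (G : SignedGraph α β) (k : ℕ) : Prop :=
  ∃ (τ : G.Orientation) (φ : E(G.graph) → ℤ),
    IsFlow τ φ ∧ ∀ e, 1 ≤ |φ e| ∧ |φ e| ≤ (k : ℤ) - 1

end SignedGraph

/-! ### Coherent walks in bidirected multigraphs

A half-edge `h : ε × Fin 2` of a bidirected multigraph has a state `a h : α × ℤˣ`, its end-vertex
together with its direction there. -/

/-! Reversing the edges on which the flow is negative makes the multiplicities `m e = |φ e|` satisfy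
Kirchhoff's law in a bidirected graph, with sum at most (k - 1)|E|. It therefore suffices to cover
the support of any circulation `m` by signed circuits of total length at most 2∑m
(`exists_cover_of_isCirculation`).

Such an `m` is peeled into closed coherent walks. A shortest closed walk dominated by `m` is
irreducible (`isIrreducible_of_minimal`): a repeated state, or two interlaced pairs of visits, would
yield a shorter closed walk with no greater edge usage. Subtracting it leaves a circulation, so an
irreducible walk of length n need only be covered at cost 2n (`exists_cover_of_isIrreducible`).

In an irreducible walk a vertex is visited at most twice per period, the second time in the flipped
state. If no vertex repeats, the walk is a balanced circuit. Otherwise its closed subwalks without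
inner repetition ("leaves") are unbalanced circuits, since the departing direction changes exactly
along negative edges, and non-interlacing makes a leaf meet the rest of the walk only in its base.
Going once around, each leaf is joined to the next one found by the path between them, and the last
to the first; every such stretch is a signed circuit. Each step of the walk lies in at most two
stretches, whence 2n. -/

namespace Bidirected

variable {α ε : Type*}

/-- The other half of the edge to which `h` belongs. -/
def rev (h : ε × Fin 2) : ε × Fin 2 := (h.1, h.2 + 1)

/-- The state at the same vertex with the opposite direction. -/
def flip (x : α × ℤˣ) : α × ℤˣ := (x.1, -x.2)

@[simp] lemma rev_fst (h : ε × Fin 2) : (rev h).1 = h.1 := rfl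

@[simp] lemma flip_fst (x : α × ℤˣ) : (flip x).1 = x.1 := rfl

@[simp] lemma flip_snd (x : α × ℤˣ) : (flip x).2 = -x.2 := rfl

@[simp] lemma rev_rev (h : ε × Fin 2) : rev (rev h) = h := by
  obtain ⟨e, i⟩ := h
  fin_cases i <;> simp [rev]

@[simp] lemma flip_flip (x : α × ℤˣ) : flip (flip x) = x := by
  simp [flip]

lemma flip_ne_self (x : α × ℤˣ) : flip x ≠ x := by
  intro h
  have := congrArg Prod.snd h
  rcases Int.units_eq_one_or x.2 with h2 | h2 <;> rw [flip_snd, h2] at this <;>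
    exact absurd this (by decide)

lemma eq_or_eq_flip_of_fst_eq {x y : α × ℤˣ} (h : x.1 = y.1) : x = y ∨ x = flip y := by
  obtain ⟨x1, x2⟩ := x
  obtain ⟨y1, y2⟩ := y
  obtain rfl : x1 = y1 := h
  rcases Int.units_eq_one_or x2 with rfl | rfl <;> rcases Int.units_eq_one_or y2 with rfl | rfl <;>
    simp [flip]

lemma eq_or_eq_rev_of_fst_eq {h h' : ε × Fin 2} (H : h.1 = h'.1) : h = h' ∨ h = rev h' := by
  obtain ⟨e, i⟩ := h
  obtain ⟨e', i'⟩ := h'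
  obtain rfl : e = e' := H
  fin_cases i <;> fin_cases i' <;> simp [rev]

/-! ### Walks, edge usage and circulations. -/

variable (a : ε × Fin 2 → α × ℤˣ)

/-- The first `n` terms of `w` form a coherent walk: each half-edge at which the walk arrives has
the direction opposite to that of the half-edge at which it leaves. -/
def IsWalk (n : ℕ) (w : ℕ → ε × Fin 2) : Prop :=
  ∀ i, i + 1 < n → flip (a (rev (w i))) = a (w (i + 1))

/-- A nonempty coherent walk which is coherent at its base point, too. -/
def IsClosedWalk (n : ℕ) (w : ℕ → ε × Fin 2) : Prop :=
  0 < n ∧ IsWalk a n w ∧ flip (a (rev (w (n - 1)))) = a (w 0)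

open Classical in
/-- The number of times that the first `n` terms of `w` use the edge `e`. -/
noncomputable def usage (n : ℕ) (w : ℕ → ε × Fin 2) (e : ε) : ℕ :=
  ((Finset.range n).filter fun i => (w i).1 = e).card

open Classical in
/-- The signed indicator of the vertex `v`. -/
noncomputable def charge (v : α) (x : α × ℤˣ) : ℤ := if x.1 = v then (x.2 : ℤ) else 0

/-- The excess of the edge `e` at `v`. -/
noncomputable def excess (v : α) (e : ε) : ℤ := charge v (a (e, 0)) + charge v (a (e, 1))

/-- Kirchhoff's law for edge multiplicities. -/
def IsCirculation [Fintype ε] (m : ε → ℕ) : Prop :=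
  ∀ v, ∑ e, (m e : ℤ) * excess a v e = 0

variable {a}

@[simp] lemma charge_flip (v : α) (x : α × ℤˣ) : charge v (flip x) = -charge v x := by
  by_cases h : x.1 = v <;> simp [charge, h]

lemma excess_fst (v : α) (h : ε × Fin 2) :
    excess a v h.1 = charge v (a h) + charge v (a (rev h)) := by
  obtain ⟨e, i⟩ := h
  fin_cases i
  · rfl
  · exact add_comm _ _

/-- Telescoping: at every interior visit the arriving and departing half-edges have opposite
directions and cancel, so only the two extreme half-edges remain. -/
lemma sum_excess_of_isWalk (v : α) {n : ℕ} {w : ℕ → ε × Fin 2} (hw : IsWalk a (n + 1) w) :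
    ∑ i ∈ Finset.range (n + 1), excess a v (w i).1 =
      charge v (a (w 0)) + charge v (a (rev (w n))) := by
  induction n with
  | zero => simp [excess_fst]
  | succ n ih =>
    rw [Finset.sum_range_succ, ih fun i hi => hw i (by omega), excess_fst,
      ← hw n (by omega), charge_flip]
    ring

lemma sum_usage_mul [Fintype ε] (n : ℕ) (w : ℕ → ε × Fin 2) (g : ε → ℤ) :
    ∑ e, (usage n w e : ℤ) * g e = ∑ i ∈ Finset.range n, g (w i).1 := by
  classical
  rw [← Finset.sum_fiberwise' (Finset.range n) (fun i => (w i).1) g]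
  refine Finset.sum_congr rfl fun e _ => ?_
  rw [Finset.sum_const, nsmul_eq_mul, usage]

lemma sum_usage [Fintype ε] (n : ℕ) (w : ℕ → ε × Fin 2) : ∑ e, usage n w e = n := by
  have := sum_usage_mul n w fun _ => 1
  simp only [mul_one, Finset.sum_const, Finset.card_range, nsmul_eq_mul] at this
  exact_mod_cast this

lemma usage_congr {n : ℕ} {w w' : ℕ → ε × Fin 2} (h : ∀ i < n, w i = w' i) :
    usage n w = usage n w' := by
  classical
  funext e
  unfold usage
  congr 1
  refine Finset.filter_congr fun i hi => ?_
  rw [h i (Finset.mem_range.1 hi)]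

lemma usage_succ [DecidableEq ε] (n : ℕ) (w : ℕ → ε × Fin 2) (e : ε) :
    usage (n + 1) w e = usage n w e + if (w n).1 = e then 1 else 0 := by
  classical
  unfold usage
  rw [Finset.range_add_one, Finset.filter_insert]
  split_ifs
  · rw [Finset.card_insert_of_notMem (by simp)]
  · rfl

lemma usage_pos_iff {n : ℕ} {w : ℕ → ε × Fin 2} {e : ε} :
    0 < usage n w e ↔ ∃ i < n, (w i).1 = e := by
  simp [usage, Finset.card_pos, Finset.Nonempty]

/-! ### Extracting closed walks from a circulation. -/

/-- A coherent walk within the support of a circulation which is not closed can be prolonged. -/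
lemma exists_prolongation [Fintype ε] {m : ε → ℕ} (hm : IsCirculation a m) {n : ℕ}
    {w : ℕ → ε × Fin 2} (hw : IsWalk a (n + 1) w) (hu : ∀ e, usage (n + 1) w e ≤ m e)
    (hne : flip (a (rev (w n))) ≠ a (w 0)) :
    ∃ w', IsWalk a (n + 2) w' ∧ ∀ e, usage (n + 2) w' e ≤ m e := by
  classical
  obtain ⟨y, hy⟩ : ∃ y, flip (a (rev (w n))) = y := ⟨_, rfl⟩
  have hyr : a (rev (w n)) = flip y := by simp [← hy]
  rw [hy] at hne
  -- The state `y` is the one in which the walk must depart next. Measured in the direction `y.2`,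
  -- the unused multiplicities have excess 1 at `y.1` if the walk started at another vertex, and 2
  -- if it started in `flip y`; so some edge with copies left has a half-edge in state `y`.
  have key : ∑ e, ((m e : ℤ) - usage (n + 1) w e) * ((y.2 : ℤ) * excess a y.1 e) > 0 := by
    have h1 : ∑ e, ((m e : ℤ) - usage (n + 1) w e) * ((y.2 : ℤ) * excess a y.1 e) =
        (y.2 : ℤ) * (charge y.1 y - charge y.1 (a (w 0))) := by
      have h2 := sum_usage_mul (n + 1) w (excess a y.1)
      rw [sum_excess_of_isWalk y.1 hw, hyr, charge_flip] at h2
      calc _ = (y.2 : ℤ) * (∑ e, (m e : ℤ) * excess a y.1 e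
            - ∑ e, (usage (n + 1) w e : ℤ) * excess a y.1 e) := by
            rw [← Finset.sum_sub_distrib, Finset.mul_sum]
            exact Finset.sum_congr rfl fun e _ => by ring
        _ = _ := by rw [hm, h2]; ring
    rw [h1]
    by_cases h0 : (a (w 0)).1 = y.1
    · have h3 : a (w 0) = flip y := (eq_or_eq_flip_of_fst_eq h0).resolve_left fun h => hne h.symm
      rw [h3, charge_flip]
      rcases Int.units_eq_one_or y.2 with h | h <;> simp [charge, h]
    · rcases Int.units_eq_one_or y.2 with h | h <;> simp [charge, h, h0]
  obtain ⟨e, -, he⟩ := Finset.exists_lt_of_sum_lt (s := Finset.univ) (f := fun _ : ε => (0 : ℤ))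
    (by simpa using key)
  have hmu : (0 : ℤ) ≤ (m e : ℤ) - usage (n + 1) w e := by
    have := hu e
    omega
  have hlt : (0 : ℤ) < (m e : ℤ) - usage (n + 1) w e := by
    rcases hmu.eq_or_lt with h | h
    · simp [← h] at he
    · exact h
  have hpos : 0 < (y.2 : ℤ) * excess a y.1 e := pos_of_mul_pos_right he hmu
  have hmem : ∃ j, a (e, j) = y := by
    by_contra! hcon
    have hle : ∀ j, (y.2 : ℤ) * charge y.1 (a (e, j)) ≤ 0 := by
      intro j
      by_cases h0 : (a (e, j)).1 = y.1
      · rw [(eq_or_eq_flip_of_fst_eq h0).resolve_left (hcon j), charge_flip]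
        rcases Int.units_eq_one_or y.2 with h | h <;> simp [charge, h]
      · simp [charge, h0]
    have h4 := hle 0
    have h5 := hle 1
    rw [excess, mul_add] at hpos
    omega
  obtain ⟨j, hj⟩ := hmem
  refine ⟨Function.update w (n + 1) (e, j), fun i hi => ?_, fun e' => ?_⟩
  · rw [Function.update_of_ne (by omega)]
    rcases (show i ≤ n by omega).eq_or_lt with rfl | h
    · rw [Function.update_self, hj, hy]
    · rw [Function.update_of_ne (by omega)]
      exact hw i (by omega)
  · rw [usage_succ, Function.update_self,
      usage_congr (w' := w) fun i hi => Function.update_of_ne (by omega) _ _]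
    split_ifs with h
    · obtain rfl : e = e' := h
      omega
    · exact hu e'

lemma exists_isClosedWalk [Fintype ε] {m : ε → ℕ} (hm : IsCirculation a m) {e₀ : ε}
    (he₀ : 0 < m e₀) : ∃ n w, IsClosedWalk a n w ∧ ∀ e, usage n w e ≤ m e := by
  classical
  by_contra! hcon
  have hlong : ∀ n, ∃ w, IsWalk a (n + 1) w ∧ ∀ e, usage (n + 1) w e ≤ m e := by
    intro n
    induction n with
    | zero =>
      refine ⟨fun _ => (e₀, 0), fun i hi => by omega, fun e => ?_⟩
      rw [usage_succ]
      simp only [usage, Finset.range_zero, Finset.filter_empty, Finset.card_empty, zero_add]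
      split_ifs with h
      · exact h ▸ he₀
      · exact Nat.zero_le _
    | succ n ih =>
      obtain ⟨w, hw, hu⟩ := ih
      refine exists_prolongation hm hw hu fun h => ?_
      obtain ⟨e, he⟩ := hcon (n + 1) w ⟨n.succ_pos, hw, h⟩
      exact absurd (hu e) (by omega)
  -- This walk has one step more than the multiplicities allow in total.
  obtain ⟨w, -, hu⟩ := hlong (∑ e, m e)
  have := Finset.sum_le_sum fun e (_ : e ∈ Finset.univ) => hu e
  rw [sum_usage] at this
  omega

lemma IsClosedWalk.isCirculation_sub [Fintype ε] {m : ε → ℕ} (hm : IsCirculation a m) {n : ℕ}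
    {w : ℕ → ε × Fin 2} (hw : IsClosedWalk a n w) (hu : ∀ e, usage n w e ≤ m e) :
    IsCirculation a fun e => m e - usage n w e := by
  intro v
  obtain ⟨hn, hw, hc⟩ := hw
  obtain ⟨n, rfl⟩ := Nat.exists_eq_succ_of_ne_zero hn.ne'
  have h2 := sum_usage_mul (n + 1) w (excess a v)
  rw [sum_excess_of_isWalk v hw] at h2
  have hc' : a (rev (w n)) = flip (a (w 0)) := by
    rw [← hc]; simp
  rw [hc', charge_flip, add_neg_cancel] at h2
  have : ∀ e, ((m e - usage (n + 1) w e : ℕ) : ℤ) * excess a v e =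
      m e * excess a v e - usage (n + 1) w e * excess a v e := fun e => by
    rw [Nat.cast_sub (hu e)]; ring
  rw [Finset.sum_congr rfl fun e _ => this e, Finset.sum_sub_distrib, hm v, h2, sub_zero]

/-! ### Irreducible closed walks. -/

variable (a) in
/-- A cyclic coherent walk of length `n`, extended periodically, which revisits no state within a
period and in which the two visits to a vertex never interlace with those to another vertex. -/
structure IsIrreducible (n : ℕ) (d : ℕ → ε × Fin 2) : Prop where
  pos : 0 < n
  periodic : ∀ i, d (i + n) = d i
  step : ∀ i, flip (a (rev (d i))) = a (d (i + 1))
  le_of_eq : ∀ i j, i < j → a (d i) = a (d j) → i + n ≤ j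
  not_cross : ∀ i j k l, i < j → j < k → k < l → l < i + n → a (d k) = flip (a (d i)) →
    a (d l) ≠ flip (a (d j))

/-- Any window of one period gives the same usage, so a walk assembled from distinct steps of one
window, possibly traversed backwards, uses no edge more often. -/
lemma usage_le_of_injOn {n n' i₀ : ℕ} {d w : ℕ → ε × Fin 2} (hd : ∀ i, d (i + n) = d i)
    (g : ℕ → ℕ) (hg : ∀ i < n', i₀ ≤ g i ∧ g i < i₀ + n) (hinj : Set.InjOn g (Set.Iio n'))
    (hw : ∀ i < n', (w i).1 = (d (g i)).1) (e : ε) : usage n' w e ≤ usage n d e := by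
  classical
  have h1 : ((Finset.Ico i₀ (i₀ + n)).filter fun i => (d i).1 = e).card = usage n d e := by
    have hp : Function.Periodic (fun i => (d i).1 = e) n := fun i => by simp only [hd]
    rw [Nat.filter_Ico_card_eq_of_periodic _ _ _ hp, usage, Nat.count_eq_card_filter_range]
  rw [← h1]
  refine Finset.card_le_card_of_injOn g (fun i hi => ?_) (hinj.mono fun i hi => ?_)
  · have hi' := Finset.mem_filter.1 (Finset.mem_coe.1 hi)
    have hlt := Finset.mem_range.1 hi'.1
    have := hg i hlt
    simp only [Finset.coe_filter, Finset.mem_Ico, Set.mem_ofPred_eq]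
    exact ⟨this, by rw [← hw i hlt, hi'.2]⟩
  · exact Finset.mem_range.1 (Finset.mem_filter.1 (Finset.mem_coe.1 hi)).1

lemma isIrreducible_of_minimal {n : ℕ} {w : ℕ → ε × Fin 2} (hw : IsClosedWalk a n w)
    (hmin : ∀ n' w', IsClosedWalk a n' w' → (∀ e, usage n' w' e ≤ usage n w e) → n ≤ n') :
    IsIrreducible a n fun i => w (i % n) := by
  obtain ⟨hn, hw, hc⟩ := hw
  set d : ℕ → ε × Fin 2 := fun i => w (i % n) with hd
  have hper : ∀ i, d (i + n) = d i := fun i => by simp [hd]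
  have hstep : ∀ i, flip (a (rev (d i))) = a (d (i + 1)) := by
    intro i
    have hlt := Nat.mod_lt i hn
    simp only [hd, Nat.add_mod i 1 n]
    rcases (show i % n + 1 ≤ n by omega).eq_or_lt with h | h
    · have h1 : i % n = n - 1 := by omega
      have h2 : (i % n + 1 % n) % n = 0 := by
        rw [Nat.add_mod_mod, h, Nat.mod_self]
      rw [h2, h1, hc]
    · have h2 : (i % n + 1 % n) % n = i % n + 1 := by
        rw [Nat.add_mod_mod, Nat.mod_eq_of_lt h]
      rw [h2]
      exact hw _ h
  have hud : usage n w = usage n d := usage_congr fun i hi => by simp [hd, Nat.mod_eq_of_lt hi]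
  rw [hud] at hmin
  refine ⟨hn, hper, hstep, fun i j hij h => ?_, fun i j k l hij hjk hkl hli hik hjl => ?_⟩
  -- A state repeated within a period cuts off the closed walk from `i` to `j`, which is too short.
  · by_contra! hlt
    have := hmin (j - i) (fun t => d (i + t)) ⟨by omega, fun t _ => hstep _, by
        simp only
        rw [hstep, add_zero, h]
        congr 2
        omega⟩
      (usage_le_of_injOn (i₀ := i) hper (fun t => i + t) (fun t ht => by omega)
        (fun _ _ _ _ h => by simpa using h) (fun _ _ => rfl))
    omega
  · have hrev : ∀ t, a (rev (d t)) = flip (a (d (t + 1))) := fun t => by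
      rw [← hstep, flip_flip]
    -- For interlaced visits, go forwards from `i` to `j`, then backwards from `l` to `k`. The two
    -- flips are precisely coherence at both junctions, and the parts from `j` to `k` and from `l`
    -- to `i + n` are saved.
    set w' : ℕ → ε × Fin 2 := fun t =>
      if t < j - i then d (i + t) else rev (d (l - 1 - (t - (j - i)))) with hw'
    have h1 : ∀ t < j - i, w' t = d (i + t) := fun t ht => by simp [hw', ht]
    have h2 : ∀ t, j - i ≤ t → w' t = rev (d (l - 1 - (t - (j - i)))) := fun t ht => by
      simp [hw', Nat.not_lt.2 ht]
    have := hmin ((j - i) + (l - k)) w' ⟨by omega, fun t ht => ?_, ?_⟩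
      (usage_le_of_injOn (i₀ := i) hper
        (fun t => if t < j - i then i + t else l - 1 - (t - (j - i))) (fun t ht => by
          split_ifs <;> omega)
        (fun t ht t' ht' h => by
          simp only [Set.mem_Iio] at ht ht'
          simp only at h
          split_ifs at h <;> omega)
        (fun t ht => by
          simp only [hw']
          split_ifs <;> rfl))
    · omega
    · rcases lt_trichotomy (t + 1) (j - i) with h | h | h
      · rw [h1 t (by omega), h1 _ h, hstep]; rfl
      · rw [h1 t (by omega), h2 _ h.ge, hstep, hrev, h, Nat.sub_self,
          show l - 1 - 0 + 1 = l by omega, hjl, flip_flip, show i + t + 1 = j by omega]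
      · rw [h2 t (by omega), h2 (t + 1) (by omega), rev_rev, hrev]
        congr 3
        omega
    · rw [h2 _ (by omega), h1 0 (by omega), rev_rev,
        show l - 1 - (j - i + (l - k) - 1 - (j - i)) = k by omega, hik, flip_flip]
      rfl

/-- Every nonzero circulation dominates an irreducible closed walk. -/
lemma exists_isIrreducible [Fintype ε] {m : ε → ℕ} (hm : IsCirculation a m) {e₀ : ε}
    (he₀ : 0 < m e₀) : ∃ n d, IsIrreducible a n d ∧ (∀ e, usage n d e ≤ m e) ∧
      IsCirculation a fun e => m e - usage n d e := by
  classical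
  have hex : ∃ n, ∃ w, IsClosedWalk a n w ∧ ∀ e, usage n w e ≤ m e := exists_isClosedWalk hm he₀
  obtain ⟨w, hw, hu⟩ := Nat.find_spec hex
  set n := Nat.find hex
  have hirr := isIrreducible_of_minimal hw fun n' w' hw' hu' =>
    Nat.find_min' hex ⟨w', hw', fun e => (hu' e).trans (hu e)⟩
  have hud : usage n w = usage n fun i => w (i % n) :=
    usage_congr fun i hi => by simp [Nat.mod_eq_of_lt hi]
  exact ⟨n, _, hirr, hud ▸ hu, hud ▸ hw.isCirculation_sub hm hu⟩

end Bidirected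

/-! ### The subgraph traversed by a walk -/

namespace Graph

variable {α β : Type*} {G : Graph α β} {v : ℕ → α} {f : ℕ → β}

/-- The subgraph formed by the vertices `v s, …, v t` and the edges `f s, …, f (t - 1)` of an
infinite walk. -/
def ofWalk (hw : ∀ i, G.IsLink (f i) (v i) (v (i + 1))) (s t : ℕ) : Graph α β where
  vertexSet := v '' Set.Icc s t
  IsLink e x y := e ∈ f '' Set.Ico s t ∧ G.IsLink e x y
  edgeSet := f '' Set.Ico s t
  isLink_symm e _ := ⟨fun _ _ h => ⟨h.1, h.2.symm⟩⟩
  eq_or_eq_of_isLink_of_isLink _ _ _ _ _ h h' := h.2.left_eq_or_eq h'.2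
  edge_mem_iff_exists_isLink e := by
    refine ⟨fun he => ?_, fun ⟨_, _, h⟩ => h.1⟩
    obtain ⟨i, hi, rfl⟩ := he
    exact ⟨_, _, ⟨i, hi, rfl⟩, hw i⟩
  left_mem_of_isLink := by
    rintro _ x y ⟨⟨i, hi, rfl⟩, h⟩
    rcases h.left_eq_or_eq (hw i) with rfl | rfl
    · exact ⟨i, ⟨hi.1, hi.2.le⟩, rfl⟩
    · exact ⟨i + 1, ⟨hi.1.trans i.le_succ, hi.2⟩, rfl⟩

variable (hw : ∀ i, G.IsLink (f i) (v i) (v (i + 1))) {s t : ℕ}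

lemma vertexSet_ofWalk : V(ofWalk hw s t) = v '' Set.Icc s t := rfl

lemma edgeSet_ofWalk : E(ofWalk hw s t) = f '' Set.Ico s t := rfl

lemma isLink_ofWalk {i : ℕ} (hs : s ≤ i) (ht : i < t) :
    (ofWalk hw s t).IsLink (f i) (v i) (v (i + 1)) :=
  ⟨⟨i, ⟨hs, ht⟩, rfl⟩, hw i⟩

lemma ofWalk_le : ofWalk hw s t ≤ G where
  vertexSet_mono := by
    rintro _ ⟨i, -, rfl⟩
    exact (hw i).left_mem
  isLink_mono _ _ _ h := h.2

lemma image_Icc_eq_image_Ico (hst : s < t) (h : v t = v s) :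
    v '' Set.Icc s t = v '' Set.Ico s t := by
  refine Set.Subset.antisymm ?_ (Set.image_mono Set.Ico_subset_Icc_self)
  rintro _ ⟨i, hi, rfl⟩
  rcases hi.2.eq_or_lt with rfl | h'
  · exact ⟨s, ⟨le_rfl, hst⟩, h.symm⟩
  · exact ⟨i, ⟨hi.1, h'⟩, rfl⟩

lemma image_Ico_eq_range {γ : Type*} (g : ℕ → γ) (s n : ℕ) :
    g '' Set.Ico s (s + n) = Set.range fun i : Fin n => g (s + i) := by
  ext y
  constructor
  · rintro ⟨i, hi, rfl⟩
    exact ⟨⟨i - s, by have := hi.1; have := hi.2; omega⟩, by simp [Nat.add_sub_cancel' hi.1]⟩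
  · rintro ⟨i, rfl⟩
    exact ⟨_, ⟨by omega, by omega⟩, rfl⟩

lemma ncard_edgeSet_ofWalk_le : E(ofWalk hw s t).ncard ≤ t - s := by
  rw [edgeSet_ofWalk]
  refine (Set.ncard_image_le (Set.finite_Ico s t)).trans ?_
  rw [← Finset.coe_Ico, Set.ncard_coe_finset, Nat.card_Ico]

lemma isCircuit_ofWalk (hst : s < t) (h : v t = v s) (hv : Set.InjOn v (Set.Ico s t))
    (hf : Set.InjOn f (Set.Ico s t)) : (ofWalk hw s t).IsCircuit := by
  obtain ⟨n, rfl⟩ := Nat.exists_eq_add_of_lt hst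
  have hmem : ∀ i : Fin (n + 1), s + i ∈ Set.Ico s (s + n + 1) := fun i =>
    ⟨by omega, by omega⟩
  refine ⟨n, fun i => v (s + i), fun i => f (s + i), fun i j hij => ?_, fun i j hij => ?_,
    ?_, ?_, fun i => ?_⟩
  · have := hv (hmem i) (hmem j) hij
    exact Fin.ext (by omega)
  · have := hf (hmem i) (hmem j) hij
    exact Fin.ext (by omega)
  · rw [vertexSet_ofWalk, image_Icc_eq_image_Ico hst h, add_assoc, image_Ico_eq_range]
  · rw [edgeSet_ofWalk, add_assoc, image_Ico_eq_range]
  · have hl := isLink_ofWalk hw (hmem i).1 (hmem i).2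
    -- Only the last edge wraps around modulo `n + 1`; there `v t = v s` is needed.
    rcases Fin.eq_castSucc_or_eq_last i with ⟨j, rfl⟩ | rfl
    · simpa [Fin.coeSucc_eq_succ, add_assoc] using hl
    · simpa [h, ← add_assoc] using hl

lemma isPathBetween_ofWalk (hst : s ≤ t) (hv : Set.InjOn v (Set.Icc s t)) :
    (ofWalk hw s t).IsPathBetween (v s) (v t) := by
  obtain ⟨n, rfl⟩ := Nat.exists_eq_add_of_le hst
  have hmem : ∀ i : Fin (n + 1), s + i ∈ Set.Icc s (s + n) := fun i => ⟨by omega, by omega⟩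
  refine ⟨n, fun i => v (s + i), fun i => f (s + i), fun i j hij => ?_, by simp, by simp, ?_, ?_,
    fun i => ?_⟩
  · have := hv (hmem i) (hmem j) hij
    exact Fin.ext (by omega)
  · rw [vertexSet_ofWalk, ← Set.Ico_add_one_right_eq_Icc, add_assoc, image_Ico_eq_range]
  · rw [edgeSet_ofWalk, image_Ico_eq_range]
  · simpa [← add_assoc] using isLink_ofWalk hw (s := s) (t := s + n) (i := s + i) (by omega)
      (by omega)

end Graph

open Bidirected Graph

/-! ### Parity of negative edges read off from states. -/

namespace SignedGraph

variable {α β : Type*} {G : SignedGraph α β} {a : E(G.graph) × Fin 2 → α × ℤˣ}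

variable (G a) in
/-- The states `a` of the half-edges are those of an orientation of `G`. -/
structure IsBidirection : Prop where
  link : ∀ h, G.graph.IsLink h.1 (a h).1 (a (rev h)).1
  sign : ∀ h, (a h).2 * (a (rev h)).2 = -G.sign h.1

variable {n : ℕ} {d : ℕ → E(G.graph) × Fin 2} {s t s' t' : ℕ}

lemma IsBidirection.isLink (ha : G.IsBidirection a)
    (hstep : ∀ i, flip (a (rev (d i))) = a (d (i + 1))) (i : ℕ) :
    G.graph.IsLink (d i).1 (a (d i)).1 (a (d (i + 1))).1 := by
  rw [← hstep]
  exact ha.link (d i)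

/-- Coherence preserves the departing direction across a positive edge and reverses it across a
negative one. Hence the end states of a subwalk show the parity of its negative steps. -/
lemma IsBidirection.snd_eq (ha : G.IsBidirection a)
    (hstep : ∀ i, flip (a (rev (d i))) = a (d (i + 1))) (hst : s ≤ t) :
    (a (d t)).2 = (-1) ^ ((Finset.Ico s t).filter fun i => G.sign (d i).1 = -1).card *
      (a (d s)).2 := by
  induction t, hst using Nat.le_induction with
  | base => simp
  | succ t hst ih =>
    have h1 : (a (d (t + 1))).2 = G.sign (d t).1 * (a (d t)).2 := by
      have h2 : G.sign (d t).1 = -((a (d t)).2 * (a (rev (d t))).2) := by rw [ha.sign, neg_neg]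
      rw [← hstep, h2, flip_snd, neg_mul, mul_right_comm, Int.units_mul_self, one_mul]
    rw [h1, ih, ← Finset.insert_Ico_right_eq_Ico_add_one hst, Finset.filter_insert]
    rcases Int.units_eq_one_or (G.sign (d t).1) with h | h
    · rw [h, if_neg (by decide), one_mul]
    · rw [h, if_pos rfl, Finset.card_insert_of_notMem (by simp), pow_succ', mul_assoc]

lemma IsBidirection.ncard_negEdges (ha : G.IsBidirection a)
    (hstep : ∀ i, flip (a (rev (d i))) = a (d (i + 1)))
    (hf : Set.InjOn (fun i => ((d i).1 : β)) (Set.Ico s t)) :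
    (G.negEdges (ofWalk (ha.isLink hstep) s t)).ncard =
      ((Finset.Ico s t).filter fun i => G.sign (d i).1 = -1).card := by
  have h : G.negEdges (ofWalk (ha.isLink hstep) s t) = (fun i => ((d i).1 : β)) ''
      ((Finset.Ico s t).filter fun i => G.sign (d i).1 = -1 : Finset ℕ) := by
    ext e
    constructor
    · rintro ⟨⟨i, hi, rfl⟩, h⟩
      exact ⟨i, by simpa [h] using hi, rfl⟩
    · rintro ⟨i, hi, rfl⟩
      simp only [Finset.coe_filter, Finset.mem_Ico, Set.mem_ofPred_eq] at hi
      exact ⟨⟨i, hi.1, rfl⟩, hi.2⟩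
  rw [h, Set.InjOn.ncard_image, Set.ncard_coe_finset]
  exact hf.mono fun i hi => by
    simp only [Finset.coe_filter, Finset.mem_Ico, Set.mem_ofPred_eq] at hi
    exact hi.1

lemma IsBidirection.even_negEdges_iff (ha : G.IsBidirection a)
    (hstep : ∀ i, flip (a (rev (d i))) = a (d (i + 1))) (hst : s ≤ t)
    (hf : Set.InjOn (fun i => ((d i).1 : β)) (Set.Ico s t)) :
    Even (G.negEdges (ofWalk (ha.isLink hstep) s t)).ncard ↔ (a (d t)).2 = (a (d s)).2 := by
  rw [ha.ncard_negEdges hstep hf, ha.snd_eq hstep hst]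
  rcases Nat.even_or_odd ((Finset.Ico s t).filter fun i => G.sign (d i).1 = -1).card with h | h
  · simp [h, h.neg_one_pow]
  · refine iff_of_false (Nat.not_even_iff_odd.2 h) ?_
    rw [h.neg_one_pow, mul_eq_right]
    decide

end SignedGraph

/-! ### How the subwalks of an irreducible walk intersect. -/

namespace Bidirected.IsIrreducible

variable {α ε : Type*} {a : ε × Fin 2 → α × ℤˣ} {n : ℕ} {d : ℕ → ε × Fin 2} {s t t' : ℕ}

lemma shift (hd : IsIrreducible a n d) (r : ℕ) : IsIrreducible a n fun i => d (i + r) where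
  pos := hd.pos
  periodic i := by
    have := hd.periodic (i + r)
    rwa [add_right_comm] at this
  step i := by
    simp only [hd.step, add_right_comm]
  le_of_eq i j hij h := by
    have := hd.le_of_eq _ _ (Nat.add_lt_add_right hij r) h
    omega
  not_cross i j k l hij hjk hkl hli :=
    hd.not_cross (i + r) (j + r) (k + r) (l + r) (by omega) (by omega) (by omega) (by omega)

lemma eq_flip (hd : IsIrreducible a n d) {i j : ℕ} (hij : i < j) (hji : j < i + n)
    (h : (a (d i)).1 = (a (d j)).1) : a (d j) = flip (a (d i)) :=
  (eq_or_eq_flip_of_fst_eq h.symm).resolve_left fun h' => by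
    have := hd.le_of_eq i j hij h'.symm
    omega

lemma fst_rev (hd : IsIrreducible a n d) (i : ℕ) : a (rev (d i)) = flip (a (d (i + 1))) := by
  rw [← hd.step, flip_flip]

/-- An edge repeated in the same direction repeats its first vertex. Repeated in the opposite
direction, it forces the second use to come immediately after the first, and then a state would
equal its own flip. -/
lemma injOn_edge (hd : IsIrreducible a n d)
    (hv : Set.InjOn (fun i => (a (d i)).1) (Set.Ico s t)) :
    Set.InjOn (fun i => (d i).1) (Set.Ico s t) := by
  have key : ∀ i ∈ Set.Ico s t, ∀ j ∈ Set.Ico s t, i < j → (d j).1 ≠ (d i).1 := by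
    intro i hi j hj hij h
    rcases eq_or_eq_rev_of_fst_eq h with h | h
    · exact hij.ne (hv hi hj (by simp [h]))
    · have h1 : a (d j) = flip (a (d (i + 1))) := by rw [h, hd.fst_rev]
      have h2 : j = i + 1 := hv hj ⟨hi.1.trans i.le_succ, lt_of_le_of_lt hij hj.2⟩ (by simp [h1])
      subst h2
      exact flip_ne_self _ h1.symm
  intro i hi j hj h
  rcases lt_trichotomy i j with hij | hij | hij
  · exact absurd h.symm (key i hi j hj hij)
  · exact hij
  · exact absurd h (key j hj i hi hij)

/-- A closed subwalk with distinct vertices meets the rest of an irreducible walk only in its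
base. -/
lemma eq_base (hd : IsIrreducible a n d) (hst : s < t) (hts : t' ≤ s + n)
    (hflip : a (d t) = flip (a (d s))) (hv : Set.InjOn (fun i => (a (d i)).1) (Set.Ico s t))
    {i j : ℕ} (hi : i ∈ Set.Ico s t) (hj : j ∈ Set.Ico t t')
    (h : (a (d i)).1 = (a (d j)).1) : i = s ∧ j = t := by
  obtain ⟨hi1, hi2⟩ := hi
  obtain ⟨hj1, hj2⟩ := hj
  have hij := hd.eq_flip (by omega) (by omega) h
  rcases hi1.eq_or_lt with rfl | hsi
  · refine ⟨rfl, ?_⟩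
    rcases hj1.eq_or_lt with rfl | htj
    · rfl
    · have := hd.le_of_eq t j htj (by rw [hflip, hij])
      omega
  · exfalso
    rcases hj1.eq_or_lt with rfl | htj
    · have := hv ⟨hsi.le, hi2⟩ ⟨le_rfl, hst⟩ (by simp [h, hflip])
      omega
    -- With `i` inside the leaf and `j` beyond it, the visits `s < i < t < j` interlace.
    · exact hd.not_cross s i t j hsi hi2 htj (by omega) hflip hij

/-- Needed since two circuits sharing one vertex might still share a loop. By `eq_base` a common
edge must start or end at the base, and each direction of use makes a state equal to its flip or
gives an index conflict. -/
lemma edge_ne (hd : IsIrreducible a n d) (hst : s < t) (hts : t' ≤ s + n)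
    (hflip : a (d t) = flip (a (d s))) (hv : Set.InjOn (fun i => (a (d i)).1) (Set.Ico s t))
    {i j : ℕ} (hi : i ∈ Set.Ico s t) (hj : j ∈ Set.Ico t t') (hv' :
      Set.InjOn (fun i => (a (d i)).1) (Set.Ico t t')) : (d i).1 ≠ (d j).1 := by
  intro h
  rcases eq_or_eq_rev_of_fst_eq h.symm with h | h
  · obtain ⟨rfl, rfl⟩ := hd.eq_base hst hts hflip hv hi hj (by rw [h])
    rw [h] at hflip
    exact flip_ne_self _ hflip.symm
  · have h1 : a (d j) = flip (a (d (i + 1))) := by rw [h, hd.fst_rev]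
    rcases (show i + 1 ≤ t from hi.2).eq_or_lt with hit | hit
    · rw [hit] at h1
      have : j = t := hv' hj ⟨le_rfl, lt_of_le_of_lt hj.1 hj.2⟩ (by simp [h1])
      rw [this] at h1
      exact flip_ne_self _ h1.symm
    · have := hd.eq_base (i := i + 1) hst hts hflip hv ⟨hi.1.trans i.le_succ, hit⟩ hj (by simp [h1])
      have := hi.1
      omega

end Bidirected.IsIrreducible

/-! ### Signed circuits in an irreducible walk, and its cover. -/

namespace SignedGraph

variable {α β : Type*} {G : SignedGraph α β} {a : E(G.graph) × Fin 2 → α × ℤˣ}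
  {n : ℕ} {d : ℕ → E(G.graph) × Fin 2} {s t s' t' : ℕ}

lemma IsBidirection.isBalancedCircuit (ha : G.IsBidirection a) (hd : IsIrreducible a n d)
    (hst : s < t) (h : a (d t) = a (d s)) (hv : Set.InjOn (fun i => (a (d i)).1) (Set.Ico s t)) :
    G.IsBalancedCircuit (ofWalk (ha.isLink hd.step) s t) := by
  have hf : Set.InjOn (fun i => ((d i).1 : β)) (Set.Ico s t) := fun i hi j hj h =>
    hd.injOn_edge hv hi hj (Subtype.ext h)
  exact ⟨ofWalk_le _, isCircuit_ofWalk _ hst (by rw [h]) hv hf,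
    (ha.even_negEdges_iff hd.step hst.le hf).2 (by rw [h])⟩

lemma IsBidirection.isUnbalancedCircuit (ha : G.IsBidirection a) (hd : IsIrreducible a n d)
    (hst : s < t) (h : a (d t) = flip (a (d s)))
    (hv : Set.InjOn (fun i => (a (d i)).1) (Set.Ico s t)) :
    G.IsUnbalancedCircuit (ofWalk (ha.isLink hd.step) s t) := by
  have hf : Set.InjOn (fun i => ((d i).1 : β)) (Set.Ico s t) := fun i hi j hj h =>
    hd.injOn_edge hv hi hj (Subtype.ext h)
  refine ⟨ofWalk_le _, isCircuit_ofWalk _ hst (by simp [h]) hv hf, ?_⟩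
  rw [ha.even_negEdges_iff hd.step hst.le hf]
  exact fun h2 => flip_ne_self (a (d s)) (Prod.ext rfl (by rw [← h, h2]))

/-- Two consecutive unbalanced closed subwalks and the path between them form a signed circuit. -/
lemma IsBidirection.isSignedCircuit_ofWalk (ha : G.IsBidirection a) (hd : IsIrreducible a n d)
    (hst : s < t) (hts : t ≤ s') (hst' : s' < t') (hn : t' ≤ s + n)
    (h : a (d t) = flip (a (d s))) (h' : a (d t') = flip (a (d s')))
    (hv : Set.InjOn (fun i => (a (d i)).1) (Set.Ico s t))
    (hv' : Set.InjOn (fun i => (a (d i)).1) (Set.Ico t t')) :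
    G.IsSignedCircuit (ofWalk (ha.isLink hd.step) s t') := by
  have hsub : Set.Ico s' t' ⊆ Set.Ico t t' := Set.Ico_subset_Ico_left hts
  have hC₁ := ha.isUnbalancedCircuit hd hst h hv
  have hC₂ := ha.isUnbalancedCircuit hd hst' h' (hv'.mono hsub)
  have hV₁ : V(ofWalk (ha.isLink hd.step) s t) = (fun i => (a (d i)).1) '' Set.Ico s t :=
    image_Icc_eq_image_Ico hst (by simp [h])
  have hV₂ : V(ofWalk (ha.isLink hd.step) s' t') = (fun i => (a (d i)).1) '' Set.Ico s' t' :=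
    image_Icc_eq_image_Ico hst' (by simp [h'])
  have hbase : ∀ {i j}, i ∈ Set.Ico s t → j ∈ Set.Ico t t' → (a (d i)).1 = (a (d j)).1 →
      i = s ∧ j = t := hd.eq_base hst hn h hv
  -- If the second leaf starts where the first one ends, the two circuits share their base;
  -- otherwise a path with at least one edge joins them.
  rcases hts.eq_or_lt with rfl | hlt
  · refine Or.inr (Or.inr ⟨ofWalk_le _, _, _, (a (d s)).1, hC₁, hC₂, ?_, ?_, ?_, ?_⟩)
    · rw [hV₁, hV₂]
      ext y
      constructor
      · rintro ⟨⟨i, hi, rfl⟩, j, hj, hij⟩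
        rw [(hbase hi hj hij.symm).1]
        rfl
      · rintro rfl
        exact ⟨⟨s, ⟨le_rfl, hst⟩, rfl⟩, t, ⟨le_rfl, hst'⟩, by simp [h]⟩
    · ext y
      refine iff_of_false ?_ (Set.notMem_empty y)
      rintro ⟨⟨i, hi, rfl⟩, j, hj, hij⟩
      exact hd.edge_ne hst hn h hv hi hj hv' (Subtype.ext hij.symm)
    · rw [vertexSet_ofWalk, vertexSet_ofWalk, vertexSet_ofWalk, ← Set.image_union,
        Set.Icc_union_Icc_eq_Icc hst.le hst'.le]
    · rw [edgeSet_ofWalk, edgeSet_ofWalk, edgeSet_ofWalk, ← Set.image_union,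
        Set.Ico_union_Ico_eq_Ico hst.le hst'.le]
  · have hvP : Set.InjOn (fun i => (a (d i)).1) (Set.Icc t s') :=
      hv'.mono (Set.Icc_subset_Ico_right hst')
    refine Or.inr (Or.inl ⟨ofWalk_le _, _, _, ofWalk (ha.isLink hd.step) t s', (a (d t)).1,
      (a (d s')).1, hC₁, hC₂, ofWalk_le _, isPathBetween_ofWalk _ hts hvP, ?_, ?_, ?_, ?_, ?_⟩)
    · rw [hV₁, hV₂]
      ext y
      refine iff_of_false ?_ (Set.notMem_empty y)
      rintro ⟨⟨i, hi, rfl⟩, j, hj, hij⟩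
      have := (hbase hi (hsub hj) hij.symm).2
      have := hj.1
      omega
    · rw [hV₁, vertexSet_ofWalk]
      ext y
      constructor
      · rintro ⟨⟨j, hj, rfl⟩, i, hi, hij⟩
        rw [(hbase hi ⟨hj.1, lt_of_le_of_lt hj.2 hst'⟩ hij).2]
        rfl
      · rintro rfl
        exact ⟨⟨t, ⟨le_rfl, hts⟩, rfl⟩, s, ⟨le_rfl, hst⟩, by simp [h]⟩
    · rw [hV₂, vertexSet_ofWalk]
      ext y
      constructor
      · rintro ⟨⟨j, hj, rfl⟩, i, hi, hij⟩
        have := hv' (hsub hi) ⟨hj.1, lt_of_le_of_lt hj.2 hst'⟩ hij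
        have h1 := hi.1
        have h2 := hj.2
        rw [show j = s' by omega]
        rfl
      · rintro rfl
        exact ⟨⟨s', ⟨hts, le_rfl⟩, rfl⟩, s', ⟨le_rfl, hst'⟩, rfl⟩
    · simp only [vertexSet_ofWalk]
      rw [Set.union_right_comm, ← Set.image_union, ← Set.image_union,
        Set.Icc_union_Icc_eq_Icc hst.le hts, Set.Icc_union_Icc_eq_Icc (hst.le.trans hts) hst'.le]
    · simp only [edgeSet_ofWalk]
      rw [Set.union_right_comm, ← Set.image_union, ← Set.image_union,
        Set.Ico_union_Ico_eq_Ico hst.le hts, Set.Ico_union_Ico_eq_Ico (hst.le.trans hts) hst'.le]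

/-- Covers are finsets, so coinciding members merge, which only decreases the total length. -/
lemma totalLength_insert_le [DecidableEq (Graph α β)] (C : Graph α β) (𝒞 : Finset (Graph α β)) :
    totalLength (insert C 𝒞) ≤ E(C).ncard + totalLength 𝒞 := by
  unfold totalLength
  by_cases h : C ∈ 𝒞
  · rw [Finset.insert_eq_of_mem h]
    exact Nat.le_add_left _ _
  · rw [Finset.sum_insert h]

lemma totalLength_union_le [DecidableEq (Graph α β)] (𝒞 𝒟 : Finset (Graph α β)) :
    totalLength (𝒞 ∪ 𝒟) ≤ totalLength 𝒞 + totalLength 𝒟 := by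
  unfold totalLength
  rw [← Finset.sum_union_inter]
  exact Nat.le_add_right _ _

/-- Given an unbalanced closed subwalk `[0, l]` with distinct vertices, the part of an irreducible
walk after a later such subwalk `[s, t]` is covered by signed circuits. -/
lemma IsBidirection.exists_cover_after_leaf (ha : G.IsBidirection a) (hd : IsIrreducible a n d)
    {l : ℕ} (hl : 0 < l) (hfl : a (d l) = flip (a (d 0)))
    (hvl : Set.InjOn (fun i => (a (d i)).1) (Set.Ico 0 l)) (hst : s < t) (htn : t ≤ n)
    (h : a (d t) = flip (a (d s))) (hv : Set.InjOn (fun i => (a (d i)).1) (Set.Ico s t))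
    (hls : l ≤ s ∨ s = 0 ∧ t = l) :
    ∃ 𝒞 : Finset (Graph α β), (∀ C ∈ 𝒞, G.IsSignedCircuit C) ∧
      (∀ i, s ≤ i → i < n → ∃ C ∈ 𝒞, ((d i).1 : β) ∈ E(C)) ∧
      totalLength 𝒞 ≤ (t - s) + 2 * (n - t) + l := by
  classical
  induction hk : n - t using Nat.strong_induction_on generalizing s t with
  | _ k ih =>
  subst hk
  have hn0 : d n = d 0 := by simpa using hd.periodic 0
  -- If nothing repeats up to time `n`, then `[s, t]` is the last leaf and is joined to the initial
  -- leaf, traversed again as `[n, n + l]`; this accounts for the summand `l`. The last leaf is not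
  -- the initial one, as times `l` and `n` both visit the base of the latter.
  by_cases hinj : Set.InjOn (fun i => (a (d i)).1) (Set.Icc t n)
  · have hls' : l ≤ s := by
      refine hls.resolve_right ?_
      rintro ⟨rfl, rfl⟩
      have : t = n := hinj ⟨le_rfl, htn⟩ ⟨htn, le_rfl⟩ (by simp [hn0, hfl])
      rw [this, hn0] at hfl
      exact flip_ne_self _ hfl.symm
    have hper : ∀ i, n ≤ i → d i = d (i - n) := fun i hi => by
      rw [← hd.periodic (i - n), Nat.sub_add_cancel hi]
    have key : ∀ i ∈ Set.Icc t n, ∀ j ∈ Set.Ioo n (n + l), (a (d i)).1 ≠ (a (d j)).1 := by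
      rintro i ⟨hi1, hi2⟩ j ⟨hj1, hj2⟩ hij
      rw [hper j hj1.le] at hij
      rcases hi2.eq_or_lt with rfl | hi2
      · rw [hn0] at hij
        have := hvl ⟨le_rfl, hl⟩ (show j - i ∈ Set.Ico 0 l from ⟨Nat.zero_le _, by omega⟩) hij
        omega
      · have := hd.eq_base (i := j - n) (j := i) (t' := n) hl (by omega) hfl hvl
          ⟨Nat.zero_le _, by omega⟩ ⟨by omega, hi2⟩ hij.symm
        omega
    have hinj' : Set.InjOn (fun i => (a (d i)).1) (Set.Ico t (n + l)) := by
      rintro i ⟨hi1, hi2⟩ j ⟨hj1, hj2⟩ hij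
      rcases le_or_gt i n with hi | hi <;> rcases le_or_gt j n with hj | hj
      · exact hinj ⟨hi1, hi⟩ ⟨hj1, hj⟩ hij
      · exact absurd hij (key i ⟨hi1, hi⟩ j ⟨hj, hj2⟩)
      · exact absurd hij.symm (key j ⟨hj1, hj⟩ i ⟨hi, hi2⟩)
      · simp only [hper i hi.le, hper j hj.le] at hij
        have := hvl (show i - n ∈ Set.Ico 0 l from ⟨Nat.zero_le _, by omega⟩)
          (show j - n ∈ Set.Ico 0 l from ⟨Nat.zero_le _, by omega⟩) hij
        omega
    refine ⟨{ofWalk (ha.isLink hd.step) s (n + l)}, ?_, fun i hi hin => ?_, ?_⟩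
    · simp only [Finset.mem_singleton, forall_eq]
      refine ha.isSignedCircuit_ofWalk hd hst htn (by omega) (by omega) h ?_ hv hinj'
      rw [add_comm n l, hd.periodic, hfl, hn0]
    · exact ⟨_, Finset.mem_singleton_self _, i, ⟨hi, by omega⟩, rfl⟩
    · rw [totalLength, Finset.sum_singleton]
      have := ncard_edgeSet_ofWalk_le (ha.isLink hd.step) (s := s) (t := n + l)
      omega
  · have hex : ∃ t', ¬ Set.InjOn (fun i => (a (d i)).1) (Set.Icc t t') := ⟨n, hinj⟩
    -- The first time `t'` at which a vertex repeats after `t` closes the next leaf `[s', t']`. The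
    -- stretch from `s` to `t'` costs `(t - s) + (t' - t)`, and the leaf is paid for once more by
    -- the induction hypothesis.
    obtain ⟨t', ht', hmin⟩ : ∃ t', (¬ Set.InjOn (fun i => (a (d i)).1) (Set.Icc t t')) ∧
        ∀ r < t', Set.InjOn (fun i => (a (d i)).1) (Set.Icc t r) :=
      ⟨Nat.find hex, Nat.find_spec hex, fun r hr => not_not.1 (Nat.find_min hex hr)⟩
    have htn' : t' ≤ n := by
      by_contra! hlt
      exact hinj (hmin n hlt)
    have htt' : t < t' := by
      by_contra! hle
      refine ht' (Set.Subsingleton.injOn (fun i hi j hj => ?_) _)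
      have := hi.1; have := hi.2; have := hj.1; have := hj.2
      omega
    have hv' : Set.InjOn (fun i => (a (d i)).1) (Set.Ico t t') :=
      (hmin (t' - 1) (by omega)).mono fun i (hi : i ∈ Set.Ico t t') =>
        show i ∈ Set.Icc t (t' - 1) from ⟨hi.1, by have := hi.2; omega⟩
    obtain ⟨s', hs', hss'⟩ : ∃ s' ∈ Set.Ico t t', (a (d s')).1 = (a (d t')).1 := by
      by_contra! hcon
      refine ht' ?_
      rintro i ⟨hi1, hi2⟩ j ⟨hj1, hj2⟩ hij
      rcases hi2.eq_or_lt with rfl | hi <;> rcases hj2.eq_or_lt with rfl | hj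
      · rfl
      · exact absurd hij.symm (hcon j ⟨hj1, hj⟩)
      · exact absurd hij (hcon i ⟨hi1, hi⟩)
      · exact hv' ⟨hi1, hi⟩ ⟨hj1, hj⟩ hij
    obtain ⟨hs1, hs2⟩ := hs'
    have hflip := hd.eq_flip hs2 (by omega) hss'
    obtain ⟨𝒞, h𝒞, hcov, hlen⟩ := ih (n - t') (by omega) hs2 htn' hflip
      (hv'.mono (Set.Ico_subset_Ico_left hs1)) (Or.inl (by omega)) rfl
    refine ⟨insert (ofWalk (ha.isLink hd.step) s t') 𝒞, ?_, fun i hi hin => ?_, ?_⟩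
    · simp only [Finset.mem_insert, forall_eq_or_imp]
      exact ⟨ha.isSignedCircuit_ofWalk hd hst hs1 hs2 (by omega) h hflip hv hv', h𝒞⟩
    · rcases lt_or_ge i t' with hit | hit
      · exact ⟨_, Finset.mem_insert_self _ _, i, ⟨hi, hit⟩, rfl⟩
      · obtain ⟨C, hC, hiC⟩ := hcov i (by omega) hin
        exact ⟨C, Finset.mem_insert_of_mem hC, hiC⟩
    · refine (totalLength_insert_le _ _).trans ?_
      have := ncard_edgeSet_ofWalk_le (ha.isLink hd.step) (s := s) (t := t')
      omega

/-- The edges of an irreducible closed walk of length `n` are covered by signed circuits of total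
length at most `2 * n`. -/
lemma IsBidirection.exists_cover_of_isIrreducible (ha : G.IsBidirection a)
    (hd : IsIrreducible a n d) :
    ∃ 𝒞 : Finset (Graph α β), (∀ C ∈ 𝒞, G.IsSignedCircuit C) ∧
      (∀ i, ∃ C ∈ 𝒞, ((d i).1 : β) ∈ E(C)) ∧ totalLength 𝒞 ≤ 2 * n := by
  classical
  by_cases hinj : Set.InjOn (fun i => (a (d i)).1) (Set.Ico 0 n)
  · have hn0 : d n = d 0 := by simpa using hd.periodic 0
    refine ⟨{ofWalk (ha.isLink hd.step) 0 n}, ?_, fun i => ⟨_, Finset.mem_singleton_self _, i % n,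
      ⟨Nat.zero_le _, Nat.mod_lt _ hd.pos⟩, ?_⟩, ?_⟩
    · simp only [Finset.mem_singleton, forall_eq]
      exact Or.inl (ha.isBalancedCircuit hd hd.pos (by rw [hn0]) hinj)
    · simp only [Function.Periodic.map_mod_nat hd.periodic i]
    · rw [totalLength, Finset.sum_singleton]
      have := ncard_edgeSet_ofWalk_le (ha.isLink hd.step) (s := 0) (t := n)
      omega
  -- A shortest return to a vertex has no inner repetition, so it is a leaf; the walk is rotated to
  -- start there. With `s = 0` and `t = l` the bound becomes `l + 2 * (n - l) + l = 2 * n`.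
  · have hex : ∃ l, ∃ i, 0 < l ∧ l < n ∧ (a (d i)).1 = (a (d (i + l))).1 := by
      simp only [Set.InjOn, not_forall] at hinj
      obtain ⟨i, hi, j, hj, hij, hne⟩ := hinj
      have := hi.2
      have := hj.2
      rcases Nat.lt_or_gt_of_ne hne with h | h
      · exact ⟨j - i, i, by omega, by omega, by rw [Nat.add_sub_cancel' h.le]; exact hij⟩
      · exact ⟨i - j, j, by omega, by omega, by rw [Nat.add_sub_cancel' h.le]; exact hij.symm⟩
    obtain ⟨r, hl, hln, hr⟩ := Nat.find_spec hex
    have hmin := fun l' (h : l' < Nat.find hex) => Nat.find_min hex h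
    set l := Nat.find hex
    have hd' := hd.shift r
    have hfl : a (d (l + r)) = flip (a (d (0 + r))) :=
      hd.eq_flip (by omega) (by omega) (by rw [zero_add, add_comm l r, hr])
    have hvl : Set.InjOn (fun i => (a (d (i + r))).1) (Set.Ico 0 l) := by
      have key : ∀ i j, i < j → j < l → (a (d (i + r))).1 ≠ (a (d (j + r))).1 :=
        fun i j hij hjl h => hmin (j - i) (by omega) ⟨i + r, by omega, by omega, by
          rw [h, show i + r + (j - i) = j + r by omega]⟩
      intro i hi j hj h
      rcases lt_trichotomy i j with hij | hij | hij
      · exact absurd h (key i j hij hj.2)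
      · exact hij
      · exact absurd h.symm (key j i hij hi.2)
    obtain ⟨𝒞, h𝒞, hcov, hlen⟩ := ha.exists_cover_after_leaf hd' hl hfl hvl hl hln.le hfl hvl
      (Or.inr ⟨rfl, rfl⟩)
    refine ⟨𝒞, h𝒞, fun i => ?_, by omega⟩
    -- The rotation by `r` is undone; the `r` extra periods keep the subtraction from truncating.
    obtain ⟨C, hC, hiC⟩ := hcov ((i + r * n - r) % n) (Nat.zero_le _) (Nat.mod_lt _ hd.pos)
    refine ⟨C, hC, ?_⟩
    rw [Function.Periodic.map_mod_nat (f := fun i => d (i + r)) hd'.periodic] at hiC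
    have hrn : r ≤ r * n := Nat.le_mul_of_pos_right r hd.pos
    rw [Nat.sub_add_cancel (by omega), show d (i + r * n) = d i by
      simpa using (show Function.Periodic d n from hd.periodic).nat_mul r i] at hiC
    exact hiC

/-- The support of a circulation `m` is covered by signed circuits of total length at most twice
the sum of `m`. -/
lemma IsBidirection.exists_cover_of_isCirculation [Fintype E(G.graph)] (ha : G.IsBidirection a)
    {m : E(G.graph) → ℕ} (hm : IsCirculation a m) :
    ∃ 𝒞 : Finset (Graph α β), (∀ C ∈ 𝒞, G.IsSignedCircuit C) ∧
      (∀ e : E(G.graph), 0 < m e → ∃ C ∈ 𝒞, (e : β) ∈ E(C)) ∧ totalLength 𝒞 ≤ 2 * ∑ e, m e := by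
  classical
  induction hN : ∑ e, m e using Nat.strong_induction_on generalizing m with
  | _ N ih =>
  subst hN
  by_cases h0 : ∃ e₀, 0 < m e₀
  · obtain ⟨e₀, he₀⟩ := h0
    obtain ⟨n, d, hd, hu, hc⟩ := exists_isIrreducible hm he₀
    have hsum : ∑ e, (m e - usage n d e) + n = ∑ e, m e := by
      nth_rw 2 [← sum_usage n d]
      rw [← Finset.sum_add_distrib]
      exact Finset.sum_congr rfl fun e _ => Nat.sub_add_cancel (hu e)
    have hn := hd.pos
    obtain ⟨𝒞, h𝒞, hcov, hlen⟩ := ih _ (by omega) hc rfl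
    obtain ⟨𝒟, h𝒟, hcov', hlen'⟩ := ha.exists_cover_of_isIrreducible hd
    refine ⟨𝒞 ∪ 𝒟, fun C hC => ?_, fun e he => ?_, ?_⟩
    · rcases Finset.mem_union.1 hC with h | h
      · exact h𝒞 C h
      · exact h𝒟 C h
    · by_cases hue : 0 < usage n d e
      · obtain ⟨i, -, rfl⟩ := usage_pos_iff.1 hue
        obtain ⟨C, hC, hiC⟩ := hcov' i
        exact ⟨C, Finset.mem_union_right _ hC, hiC⟩
      · obtain ⟨C, hC, hiC⟩ := hcov e (by omega)
        exact ⟨C, Finset.mem_union_left _ hC, hiC⟩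
    · refine (totalLength_union_le _ _).trans ?_
      omega
  · refine ⟨∅, by simp, fun e he => absurd ⟨e, he⟩ h0, by simp [totalLength]⟩

/-! ### From nowhere-zero flows to circulations. -/

open Classical in
/-- The states of the half-edges after reversal of the edges on which `φ` is negative. -/
noncomputable def Orientation.state (τ : G.Orientation) (φ : E(G.graph) → ℤ)
    (h : E(G.graph) × Fin 2) : α × ℤˣ :=
  (τ.endpoint h.1 h.2, if φ h.1 < 0 then -τ.dir h.1 h.2 else τ.dir h.1 h.2)

lemma Orientation.isBidirection_state (τ : G.Orientation) (φ : E(G.graph) → ℤ) :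
    G.IsBidirection (τ.state φ) where
  link h := by
    obtain ⟨e, i⟩ := h
    fin_cases i
    · exact τ.isLink e
    · exact (τ.isLink e).symm
  sign h := by
    obtain ⟨e, i⟩ := h
    have h0 := τ.compat e
    have h1 : τ.dir e 1 * τ.dir e 0 = -G.sign e := by rw [mul_comm, h0]
    fin_cases i <;> by_cases hφ : φ e < 0 <;> simp [Orientation.state, rev, hφ, h0, h1]

/-- Reversing an edge changes the sign of its charge exactly when passing to the absolute value
changes the sign of `φ`. -/
lemma Orientation.natAbs_mul_charge_state (τ : G.Orientation) (φ : E(G.graph) → ℤ) (v : α)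
    (h : E(G.graph) × Fin 2) [Decidable (τ.endpoint h.1 h.2 = v)] :
    ((φ h.1).natAbs : ℤ) * charge v (τ.state φ h) =
      if τ.endpoint h.1 h.2 = v then φ h.1 * (τ.dir h.1 h.2 : ℤ) else 0 := by
  by_cases hv : τ.endpoint h.1 h.2 = v
  · by_cases hφ : φ h.1 < 0
    · simp [charge, Orientation.state, hv, hφ, abs_of_neg hφ]
    · simp [charge, Orientation.state, hv, hφ, abs_of_nonneg (not_lt.1 hφ)]
  · simp [charge, Orientation.state, hv]

lemma IsFlow.isCirculation [Fintype E(G.graph)] {τ : G.Orientation} {φ : E(G.graph) → ℤ}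
    (hφ : IsFlow τ φ) : IsCirculation (τ.state φ) fun e => (φ e).natAbs := by
  classical
  intro v
  have h1 : ∑ e, ((φ e).natAbs : ℤ) * excess (τ.state φ) v e =
      ∑ h : E(G.graph) × Fin 2, if τ.endpoint h.1 h.2 = v then φ h.1 * (τ.dir h.1 h.2 : ℤ)
        else 0 := by
    rw [Fintype.sum_prod_type]
    refine Finset.sum_congr rfl fun e _ => ?_
    rw [Fin.sum_univ_two, excess, mul_add]
    exact congrArg₂ _ (τ.natAbs_mul_charge_state φ v (e, 0))
      (τ.natAbs_mul_charge_state φ v (e, 1))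
  rw [h1]
  by_cases hv : v ∈ V(G.graph)
  · have h2 := hφ v hv
    rw [finsum_mem_eq_finite_toFinset_sum _ (Set.toFinite _),
      finsum_mem_eq_finite_toFinset_sum _ (Set.toFinite _), ← sub_eq_zero] at h2
    refine Eq.trans ?_ h2
    rw [← Finset.sum_filter_add_sum_filter_not _ fun h => τ.dir h.1 h.2 = 1, sub_eq_add_neg,
      ← Finset.sum_neg_distrib]
    have hin : (Set.toFinite (τ.incoming v)).toFinset = Finset.univ.filter fun h =>
        τ.endpoint h.1 h.2 = v ∧ τ.dir h.1 h.2 = 1 := by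
      ext h; simp [Orientation.incoming]
    have hout : (Set.toFinite (τ.outgoing v)).toFinset = Finset.univ.filter fun h =>
        τ.endpoint h.1 h.2 = v ∧ τ.dir h.1 h.2 = -1 := by
      ext h; simp [Orientation.outgoing]
    rw [hin, hout, Finset.sum_filter, Finset.sum_filter, Finset.sum_filter, Finset.sum_filter]
    congr 1 <;> refine Finset.sum_congr rfl fun h _ => ?_ <;>
      rcases Int.units_eq_one_or (τ.dir h.1 h.2) with hd | hd <;> simp [hd]
  -- `IsCirculation` ranges over all of `α`; off the vertex set there are no half-edges.
  · refine Finset.sum_eq_zero fun h _ => if_neg ?_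
    rintro rfl
    exact hv ((τ.isBidirection_state φ).link h).left_mem

end SignedGraph

theorem mainTheorem4 {α β : Type*} (G : SignedGraph α β) (hG : E(G.graph).Finite)
    (k : ℕ) (hk : 2 ≤ k) (hflow : G.AdmitsNowhereZeroFlow k) :
    ∃ 𝒞 : Finset (Graph α β), G.IsSignedCircuitCover 𝒞 ∧
      SignedGraph.totalLength 𝒞 ≤ 2 * (k - 1) * E(G.graph).ncard := by
  obtain ⟨τ, φ, hφ, hbound⟩ := hflow
  have := hG.fintype
  obtain ⟨𝒞, h𝒞, hcov, hlen⟩ :=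
    (τ.isBidirection_state φ).exists_cover_of_isCirculation hφ.isCirculation
  refine ⟨𝒞, ⟨h𝒞, fun e he => hcov ⟨e, he⟩ ?_⟩, hlen.trans ?_⟩
  · have := (hbound ⟨e, he⟩).1
    exact Int.natAbs_pos.2 fun h0 => by simp [h0] at this
  · rw [mul_assoc]
    refine Nat.mul_le_mul_left 2 ?_
    refine (Finset.sum_le_card_nsmul _ _ (k - 1) fun e _ => ?_).trans ?_
    · have := (hbound e).2
      rw [Int.abs_eq_natAbs] at this
      omega
    · rw [Finset.card_univ, smul_eq_mul, mul_comm, ← Nat.card_eq_fintype_card,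
        Nat.card_coe_set_eq]
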